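/- Let $U$ be a finite set and let $\mathcal C\subseteq 2^U$ be a covering of $U$, i.e. $\bigcup_{K\in\mathcal C}K=U$. Let $M(\mathcal C)$ be the transversal matroid of $\mathcal C$ (the matroid on $U$ whose independent sets are the partial transversals of $\mathcal C$), and let $L(\mathcal C)$ be its lattice of closed sets (flats), ordered by inclusion. For $x\in U$ put $\mathcal C(x)=\{K\in\mathcal C: x\in K\}$ and $E(x)=\{y\in U:\mathcal C(y)\subseteq\mathcal C(x)\}$, and let $\mathcal E=\{E(x): x\in U,\ |\mathcal C(x)|=2\}$. Call $\mathcal C$ reduced if no two distinct $x,y\in U$ satisfy $\mathcal C(x)=\mathcal C(y)$ and $|\mathcal C(x)|=1$ (equivalently, the atoms of $L(\mathcal C)$ are exactly the singletons $\{x\}$, $x\in U$). Let $V$ be an $n$-dimensional vector space over a finite field with $q$ elements, and let $L(V)$ be its lattice of subspaces, ordered by inclusion. Suppose that $L(\mathcal C)\cong L(V)$ as lattices. Then $n\le 2$. If moreover $n=2$, then $L(\mathcal C)$ has exactly $m=q+1$ elements of height $1$ (so $|U|=m=q+1$ if $\mathcal C$ is reduced), $\mathcal E$ is a partition of $U$,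 and its number of blocks is $k=|\mathcal E|=1$. -/

import Mathlib

namespace CoveringLattice

/-- A set of subsets of `U` is a covering of `U` if its union is `U`. -/
def IsCovering {U : Type*} (C : Set (Set U)) : Prop :=
  ⋃₀ C = Set.univ

/-- `I` is a partial transversal of `C`: its elements have pairwise distinct representing
blocks of `C`. -/
def IsPartialTransversal {U : Type*} (C : Set (Set U)) (I : Set U) : Prop :=
  ∃ f : U → Set U, Set.InjOn f I ∧ ∀ x ∈ I, f x ∈ C ∧ x ∈ f x

theorem isPartialTransversal_empty {U : Type*} (C : Set (Set U)) :
    IsPartialTransversal C ∅ :=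
  ⟨fun _ => ∅, by simp, by simp⟩

theorem IsPartialTransversal.subset {U : Type*} {C : Set (Set U)} {I J : Set U}
    (hJ : IsPartialTransversal C J) (hIJ : I ⊆ J) : IsPartialTransversal C I := by
  obtain ⟨f, hf, hC⟩ := hJ
  exact ⟨f, hf.mono hIJ, fun x hx => hC x (hIJ hx)⟩

/-- The augmentation axiom. -/
theorem IsPartialTransversal.augment {U : Type*} [Finite U] {C : Set (Set U)} {I J : Set U}
    (hI : IsPartialTransversal C I) (hJ : IsPartialTransversal C J) (hlt : I.ncard < J.ncard) :
    ∃ e ∈ J, e ∉ I ∧ IsPartialTransversal C (insert e I) := by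
  classical
  obtain ⟨g, hg, hgC⟩ := hJ
  -- induct on the number of points where the two representing maps disagree
  suffices H : ∀ (n : ℕ) (f : U → Set U), Set.InjOn f I → (∀ x ∈ I, f x ∈ C ∧ x ∈ f x) →
      {x | f x ≠ g x}.ncard = n →
      ∃ e ∈ J, e ∉ I ∧ IsPartialTransversal C (insert e I) by
    obtain ⟨f, hf, hfC⟩ := hI
    exact H _ f hf hfC rfl
  intro n
  induction n using Nat.strong_induction_on with
  | _ n ih =>
    intro f hf hfC hn
    have hex : ∃ y ∈ J, g y ∉ f '' I := by
      by_contra! hcon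
      have h1 : g '' J ⊆ f '' I := by
        rintro _ ⟨y, hy, rfl⟩
        exact hcon y hy
      have h2 := Set.ncard_le_ncard h1 (Set.toFinite _)
      rw [hg.ncard_image, hf.ncard_image] at h2
      omega
    obtain ⟨y, hyJ, hy⟩ := hex
    have hne : ∀ x ∈ I, f x ≠ g y := fun x hx h => hy ⟨x, hx, h⟩
    have hinj : Set.InjOn (Function.update f y (g y)) (insert y I) := by
      intro a ha b hb hab
      by_cases hay : a = y <;> by_cases hby : b = y
      · rw [hay, hby]
      · subst hay
        rw [Function.update_self, Function.update_of_ne hby] at hab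
        exact absurd hab.symm (hne b (hb.resolve_left hby))
      · subst hby
        rw [Function.update_self, Function.update_of_ne hay] at hab
        exact absurd hab (hne a (ha.resolve_left hay))
      · rw [Function.update_of_ne hay, Function.update_of_ne hby] at hab
        exact hf (ha.resolve_left hay) (hb.resolve_left hby) hab
    have hmem : ∀ x ∈ insert y I, Function.update f y (g y) x ∈ C ∧
        x ∈ Function.update f y (g y) x := by
      intro x hx
      by_cases hxy : x = y
      · subst hxy
        rw [Function.update_self]
        exact hgC x hyJ
      · rw [Function.update_of_ne hxy]
        exact hfC x (hx.resolve_left hxy)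
    by_cases hyI : y ∈ I
    · refine ih _ ?_ (Function.update f y (g y)) (hinj.mono (Set.subset_insert y I))
        (fun x hx => hmem x (Set.mem_insert_of_mem y hx)) rfl
      rw [← hn]
      refine Set.ncard_lt_ncard ⟨?_, ?_⟩ (Set.toFinite _)
      · intro x hx hfx
        apply hx
        by_cases hxy : x = y
        · subst hxy
          rw [Function.update_self]
        · rw [Function.update_of_ne hxy, hfx]
      · intro hsub
        have h3 : y ∈ {x | Function.update f y (g y) x ≠ g x} := hsub (hne y hyI)
        exact h3 (by rw [Function.update_self])
    · exact ⟨y, hyJ, hyI, _, hinj, hmem⟩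

/-- The transversal matroid `M(C)`: its ground set is all of `U`, and its independent sets are
the partial transversals of `C`. -/
def transversalMatroid {U : Type*} [Finite U] (C : Set (Set U)) : Matroid U :=
  (IndepMatroid.ofFinite (E := Set.univ) Set.finite_univ (IsPartialTransversal C)
    (isPartialTransversal_empty C)
    (fun _ _ hJ hIJ => hJ.subset hIJ)
    (fun _ _ hI hJ hlt => hI.augment hJ hlt)
    (fun _ _ => Set.subset_univ _)).matroid

/-- The lattice `L(C)` induced by a covering: the closed sets (flats) of `M(C)`, ordered by
inclusion. -/
abbrev FlatLattice {U : Type*} [Finite U] (C : Set (Set U)) : Type _ :=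
  {X : Set U // (transversalMatroid C).IsFlat X}

/-- The `l`-th level of a poset: its elements of height `l`. -/
def level (P : Type*) [Preorder P] (l : ℕ) : Set P :=
  {x | Order.height x = l}

/-- `C({x})`, the set of blocks of `C` that contain `x`. -/
def blocksAt {U : Type*} (C : Set (Set U)) (x : U) : Set (Set U) :=
  {K | K ∈ C ∧ x ∈ K}

/-- The relation `x ∼ y`: either `x = y`, or `x` and `y` lie in one and the same block and in no
other block. -/
def Sim {U : Type*} (C : Set (Set U)) (x y : U) : Prop :=
  x = y ∨ (blocksAt C x = blocksAt C y ∧ (blocksAt C x).ncard = 1)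

/-- `C` is reduced if the classes of `∼` are singletons. -/
def IsReduced {U : Type*} (C : Set (Set U)) : Prop :=
  ∀ x y : U, Sim C x y → x = y

/-- `E({x}) = {y | C({y}) ⊆ C({x})}`. -/
def E {U : Type*} (C : Set (Set U)) (x : U) : Set U :=
  {y | blocksAt C y ⊆ blocksAt C x}

/-- The family of all sets `E({x})` with `|C({x})| = 2`. -/
def EFamily {U : Type*} (C : Set (Set U)) : Set (Set U) :=
  {S | ∃ x : U, (blocksAt C x).ncard = 2 ∧ S = E C x}

/-- The number `k` of members of that family. -/
noncomputable def numE {U : Type*} (C : Set (Set U)) : ℕ :=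
  (EFamily C).ncard

end CoveringLattice

namespace CoveringLattice

variable {U : Type*}

/-! By Hall's theorem a circuit of `M(C)` meets fewer blocks than it has elements
(`ncard_blocksMeeting_lt`). An isomorphism with `L(V)` makes elements of `U` into points of the
projective space, and three distinct points on a line form a circuit. Together they meet at most two
blocks, while any two of them, being independent, meet at least two. Hence some point of the three
lies in two blocks, since otherwise they would give three distinct blocks.

If `n ≥ 3`, take a point on two distinct lines. Were it in two blocks, those two would be the only
ones met by either line, so three independent points would meet only two blocks
(`ncard_blocksAt_le_one`). Thus every point lies in a single block, contradicting the previous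
paragraph (`finrank_le_two`).

If `n = 2`, all `q + 1 ≥ 3` points lie on one line and meet only two blocks altogether. Some point
lies in both, and every such point has `E(x) = U` (`EFamily_eq_of_line`). -/

/-- The blocks of `C` that meet `I`. -/
def blocksMeeting (C : Set (Set U)) (I : Set U) : Set (Set U) :=
  ⋃ x ∈ I, blocksAt C x

theorem mem_blocksMeeting {C : Set (Set U)} {I : Set U} {K : Set U} :
    K ∈ blocksMeeting C I ↔ ∃ x ∈ I, K ∈ blocksAt C x := by
  simp [blocksMeeting]

theorem blocksMeeting_pair (C : Set (Set U)) (a b : U) :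
    blocksMeeting C {a, b} = blocksAt C a ∪ blocksAt C b := by
  simp [blocksMeeting]

theorem blocksMeeting_triple (C : Set (Set U)) (a b c : U) :
    blocksMeeting C {a, b, c} = blocksAt C a ∪ (blocksAt C b ∪ blocksAt C c) := by
  simp [blocksMeeting]

theorem IsPartialTransversal.ncard_le [Finite U] {C : Set (Set U)} {I : Set U}
    (hI : IsPartialTransversal C I) : I.ncard ≤ (blocksMeeting C I).ncard := by
  obtain ⟨f, hf, hC⟩ := hI
  rw [← hf.ncard_image]
  refine Set.ncard_le_ncard ?_ (Set.toFinite _)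
  rintro _ ⟨x, hx, rfl⟩
  exact mem_blocksMeeting.2 ⟨x, hx, hC x hx⟩

/-- Hall's marriage theorem for partial transversals. -/
theorem isPartialTransversal_of_hall [Finite U] {C : Set (Set U)} {I : Set U}
    (h : ∀ J ⊆ I, J.ncard ≤ (blocksMeeting C J).ncard) : IsPartialTransversal C I := by
  classical
  let t : I → Finset (Set U) := fun x => (Set.toFinite (blocksAt C x.1)).toFinset
  obtain ⟨f, hf, hft⟩ := (Finset.all_card_le_biUnion_card_iff_exists_injective t).1 (by
    intro s
    have h1 := h (Subtype.val '' (s : Set I)) (by rintro _ ⟨x, -, rfl⟩; exact x.2)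
    rw [Set.ncard_image_of_injective _ Subtype.val_injective, Set.ncard_coe_finset] at h1
    refine h1.trans (le_of_eq ?_)
    rw [← Set.ncard_coe_finset]
    congr 1
    ext K
    simp [mem_blocksMeeting, t])
  -- Only the values on `I` matter, so `∅` serves as a default elsewhere.
  refine ⟨fun x => if hx : x ∈ I then f ⟨x, hx⟩ else ∅, ?_, ?_⟩
  · intro x hx y hy hxy
    simp only [hx, hy, dif_pos] at hxy
    exact congrArg Subtype.val (hf hxy)
  · intro x hx
    have := hft ⟨x, hx⟩
    simp only [hx, dif_pos]
    simpa [t, blocksAt] using this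

/-- A circuit meets fewer blocks than it has elements. -/
theorem ncard_blocksMeeting_lt [Finite U] {C : Set (Set U)} {I : Set U}
    (hI : ¬ IsPartialTransversal C I) (h : ∀ x ∈ I, IsPartialTransversal C (I \ {x})) :
    (blocksMeeting C I).ncard < I.ncard := by
  by_contra! hcon
  refine hI (isPartialTransversal_of_hall fun J hJ => ?_)
  -- Proper subsets of `I` are independent and satisfy Hall's condition; only `I` itself can violate
  -- it.
  rcases eq_or_ne J I with rfl | hne
  · exact hcon
  · obtain ⟨x, hxI, hxJ⟩ := Set.exists_of_ssubset (hJ.ssubset_of_ne hne)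
    exact ((h x hxI).subset fun y hy => ⟨hJ hy, fun hyx => hxJ (hyx ▸ hy)⟩).ncard_le

theorem blocksAt_nonempty {C : Set (Set U)} (hC : IsCovering C) (x : U) :
    (blocksAt C x).Nonempty := by
  obtain ⟨K, hK, hx⟩ : x ∈ ⋃₀ C := hC ▸ Set.mem_univ x
  exact ⟨K, hK, hx⟩

theorem isPartialTransversal_singleton {C : Set (Set U)} (hC : IsCovering C) (x : U) :
    IsPartialTransversal C {x} := by
  obtain ⟨K, hK⟩ := blocksAt_nonempty hC x
  refine ⟨fun _ => K, Set.injOn_singleton _ _, ?_⟩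
  rintro y rfl
  exact hK

variable [Finite U] {C : Set (Set U)}

@[simp] theorem transversalMatroid_ground : (transversalMatroid C).E = Set.univ := rfl

@[simp] theorem transversalMatroid_indep {I : Set U} :
    (transversalMatroid C).Indep I ↔ IsPartialTransversal C I := Iff.rfl

theorem closure_singleton_subset_iff {X : Set U} (hX : (transversalMatroid C).IsFlat X) (x : U) :
    (transversalMatroid C).closure {x} ⊆ X ↔ x ∈ X := by
  constructor
  · exact fun h => h ((transversalMatroid C).mem_closure_of_mem' rfl)
  · intro h
    rw [← hX.closure]
    exact (transversalMatroid C).closure_subset_closure (Set.singleton_subset_iff.2 h)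

/-! ### Elements of `U` as points of the lattice -/

section pointMap

variable {α : Type*} [CompleteLattice α] (φ : FlatLattice C ≃o α)

/-- The image under `φ` of the flat spanned by `x`. -/
def pointMap (x : U) : α :=
  φ ⟨(transversalMatroid C).closure {x}, Matroid.isFlat_closure _⟩

theorem pointMap_le_iff (x : U) (b : α) : pointMap φ x ≤ b ↔ x ∈ (φ.symm b).1 := by
  rw [pointMap, ← φ.le_symm_apply]
  exact closure_singleton_subset_iff (φ.symm b).2 x

/-- Closure becomes a join of points, so dependence in `M(C)` can be read off in `α`. -/
theorem mem_closure_iff_pointMap_le (X : Set U) (e : U) :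
    e ∈ (transversalMatroid C).closure X ↔ pointMap φ e ≤ ⨆ x ∈ X, pointMap φ x := by
  constructor
  · intro he
    rw [pointMap_le_iff]
    have hX : X ⊆ (φ.symm (⨆ x ∈ X, pointMap φ x)).1 := fun x hx =>
      (pointMap_le_iff φ x _).1 (le_iSup₂ (f := fun x (_ : x ∈ X) => pointMap φ x) x hx)
    have := (transversalMatroid C).closure_subset_closure hX he
    rwa [(φ.symm _).2.closure] at this
  · intro he
    let G : FlatLattice C := ⟨(transversalMatroid C).closure X, Matroid.isFlat_closure _⟩
    have h : pointMap φ e ≤ φ G := he.trans (iSup₂_le fun x hx => by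
      rw [pointMap_le_iff, φ.symm_apply_apply]
      exact (transversalMatroid C).mem_closure_of_mem' hx)
    rwa [pointMap_le_iff, φ.symm_apply_apply] at h

theorem mem_closure_singleton_iff (a e : U) :
    e ∈ (transversalMatroid C).closure {a} ↔ pointMap φ e ≤ pointMap φ a := by
  simp [mem_closure_iff_pointMap_le φ]

theorem mem_closure_pair_iff (a b e : U) :
    e ∈ (transversalMatroid C).closure {a, b} ↔ pointMap φ e ≤ pointMap φ a ⊔ pointMap φ b := by
  rw [mem_closure_iff_pointMap_le φ, iSup_pair]

theorem notMem_closure_empty (hC : IsCovering C) (x : U) :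
    x ∉ (transversalMatroid C).closure ∅ := by
  have := ((transversalMatroid C).empty_indep.insert_indep_iff_of_notMem
    (Set.notMem_empty x)).1 (by simpa using isPartialTransversal_singleton hC x)
  exact this.2

theorem exists_pointMap_le {b : α} (hb : b ≠ ⊥) : ∃ x, pointMap φ x ≤ b := by
  by_contra! h
  refine hb (le_bot_iff.1 ?_)
  rw [← φ.symm.le_iff_le]
  intro x hx
  exact absurd ((pointMap_le_iff φ x b).2 hx) (h x)

/-- A nonzero element below the point of `x` contains the point of some `y`; matroid exchange over
`∅` then puts `x` in the closure of `y`. -/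
theorem isAtom_pointMap (hC : IsCovering C) (x : U) : IsAtom (pointMap φ x) := by
  refine ⟨fun h => notMem_closure_empty hC x ?_, fun b hb => ?_⟩
  · rw [mem_closure_iff_pointMap_le φ, h]
    exact bot_le
  · by_contra hne
    obtain ⟨y, hy⟩ := exists_pointMap_le φ hne
    have h1 : y ∈ (transversalMatroid C).closure {x} :=
      (mem_closure_singleton_iff φ x y).2 (hy.trans hb.le)
    have h2 := (transversalMatroid C).closure_exchange (e := y) (f := x) (X := ∅)
      ⟨by simpa using h1, notMem_closure_empty hC y⟩
    have h3 : x ∈ (transversalMatroid C).closure {y} := by simpa using h2.1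
    exact absurd (((mem_closure_singleton_iff φ y x).1 h3).trans hy) hb.not_ge

theorem exists_pointMap_eq (hC : IsCovering C) {b : α} (hb : IsAtom b) :
    ∃ x, pointMap φ x = b := by
  obtain ⟨x, hx⟩ := exists_pointMap_le φ hb.1
  exact ⟨x, (hb.le_iff.1 hx).resolve_left (isAtom_pointMap φ hC x).1⟩

theorem ne_of_pointMap_ne {a b : U} (h : pointMap φ a ≠ pointMap φ b) : a ≠ b :=
  fun hab => h (hab ▸ rfl)

theorem isPartialTransversal_pair_iff (hC : IsCovering C) {a b : U} (hab : a ≠ b) :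
    IsPartialTransversal C {a, b} ↔ pointMap φ a ≠ pointMap φ b := by
  have hb := isPartialTransversal_singleton hC b
  rw [← transversalMatroid_indep] at hb ⊢
  rw [hb.insert_indep_iff_of_notMem (by simpa using hab), Set.mem_sdiff,
    mem_closure_singleton_iff φ, (isAtom_pointMap φ hC b).le_iff]
  simp [(isAtom_pointMap φ hC a).1]

theorem isPartialTransversal_pair (hC : IsCovering C) {a b : U}
    (h : pointMap φ a ≠ pointMap φ b) : IsPartialTransversal C {a, b} :=
  (isPartialTransversal_pair_iff φ hC (ne_of_pointMap_ne φ h)).2 h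

theorem isPartialTransversal_triple_iff (hC : IsCovering C) {a b c : U}
    (hbc : pointMap φ b ≠ pointMap φ c) (hab : a ≠ b) (hac : a ≠ c) :
    IsPartialTransversal C {a, b, c} ↔ ¬ pointMap φ a ≤ pointMap φ b ⊔ pointMap φ c := by
  have h := isPartialTransversal_pair φ hC hbc
  rw [← transversalMatroid_indep] at h ⊢
  rw [h.insert_indep_iff_of_notMem (by simp [hab, hac]), Set.mem_sdiff, mem_closure_pair_iff φ]
  simp

theorem two_le_ncard_blocksAt_union (hC : IsCovering C) {a b : U}
    (h : pointMap φ a ≠ pointMap φ b) : 2 ≤ (blocksAt C a ∪ blocksAt C b).ncard := by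
  have := (isPartialTransversal_pair φ hC h).ncard_le
  rwa [Set.ncard_pair (ne_of_pointMap_ne φ h), blocksMeeting_pair] at this

/-- Three points on a line meet at most two blocks. -/
theorem ncard_blocksAt_collinear_le (hC : IsCovering C) {a b c : U}
    (hab : pointMap φ a ≠ pointMap φ b) (hac : pointMap φ a ≠ pointMap φ c)
    (hbc : pointMap φ b ≠ pointMap φ c) (h : pointMap φ a ≤ pointMap φ b ⊔ pointMap φ c) :
    (blocksAt C a ∪ (blocksAt C b ∪ blocksAt C c)).ncard ≤ 2 := by
  have nab := ne_of_pointMap_ne φ hab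
  have nac := ne_of_pointMap_ne φ hac
  have nbc := ne_of_pointMap_ne φ hbc
  have := ncard_blocksMeeting_lt
    (fun hI => (isPartialTransversal_triple_iff φ hC hbc nab nac).1 hI h) (by
      rintro x (rfl | rfl | rfl)
      · refine (isPartialTransversal_pair φ hC hbc).subset ?_
        grind
      · refine (isPartialTransversal_pair φ hC hac).subset ?_
        grind
      · refine (isPartialTransversal_pair φ hC hab).subset ?_
        grind)
  rw [blocksMeeting_triple, Set.ncard_eq_three.2 ⟨a, b, c, nab, nac, nbc, rfl⟩] at this
  omega

end pointMap

/-- If three nonempty sets have pairwise at least two elements in their union, and at most two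
altogether, then one of them has at least two elements. -/
theorem exists_two_le_ncard_of_ncard_union_le_two {β : Type*} [Finite β] {A B D : Set β}
    (hA : A.Nonempty) (hB : B.Nonempty) (hD : D.Nonempty) (hAB : 2 ≤ (A ∪ B).ncard)
    (hAD : 2 ≤ (A ∪ D).ncard) (hBD : 2 ≤ (B ∪ D).ncard) (h : (A ∪ (B ∪ D)).ncard ≤ 2) :
    2 ≤ A.ncard ∨ 2 ≤ B.ncard ∨ 2 ≤ D.ncard := by
  by_contra! hcon
  obtain ⟨h1, h2, h3⟩ := hcon
  have key : ∀ S : Set β, S.Nonempty → S.ncard < 2 → ∃ a, S = {a} := fun S hS hlt =>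
    Set.ncard_eq_one.1 (by have := (Set.ncard_pos (Set.toFinite S)).2 hS; omega)
  obtain ⟨a, rfl⟩ := key A hA h1
  obtain ⟨b, rfl⟩ := key B hB h2
  obtain ⟨d, rfl⟩ := key D hD h3
  have hne : ∀ x y : β, 2 ≤ ({x} ∪ {y} : Set β).ncard → x ≠ y := by
    rintro x _ hxy rfl
    simp at hxy
  have : ({a} ∪ ({b} ∪ {d}) : Set β).ncard = 3 :=
    Set.ncard_eq_three.2 ⟨a, b, d, hne _ _ hAB, hne _ _ hAD, hne _ _ hBD, rfl⟩
  omega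

/-! ### Dimension at most two -/

section subspaces

variable {F : Type*} [Field F] {V : Type*} [AddCommGroup V] [Module F V]
  (φ : FlatLattice C ≃o Submodule F V)

theorem span_singleton_ne_of_linearIndependent {v w : V}
    (h : ∀ a b : F, a • v + b • w = 0 → a = 0 ∧ b = 0) :
    Submodule.span F {v} ≠ Submodule.span F {w} := by
  intro hvw
  obtain ⟨c, hc⟩ := Submodule.mem_span_singleton.1 (hvw ▸ Submodule.mem_span_singleton_self v)
  have := (h 1 (-c) (by rw [← hc]; simp)).1
  exact one_ne_zero this

/-- The points spanned by `v`, `w` and `v + w` are collinear. -/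
theorem ncard_blocksAt_line_le (hC : IsCovering C) {v w : V}
    (h : ∀ a b : F, a • v + b • w = 0 → a = 0 ∧ b = 0) {x y z : U}
    (hx : pointMap φ x = Submodule.span F {v}) (hy : pointMap φ y = Submodule.span F {w})
    (hz : pointMap φ z = Submodule.span F {v + w}) :
    (blocksAt C z ∪ (blocksAt C x ∪ blocksAt C y)).ncard ≤ 2 := by
  apply ncard_blocksAt_collinear_le φ hC
  · rw [hx, hz]
    refine span_singleton_ne_of_linearIndependent fun a b hab => ?_
    obtain ⟨h1, h2⟩ := h (a + b) a (by rw [← hab]; module)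
    grind
  · rw [hy, hz]
    refine span_singleton_ne_of_linearIndependent fun a b hab => ?_
    obtain ⟨h1, h2⟩ := h a (a + b) (by rw [← hab]; module)
    grind
  · rw [hx, hy]
    exact span_singleton_ne_of_linearIndependent h
  · rw [hx, hy, hz, Submodule.span_singleton_le_iff_mem]
    exact Submodule.add_mem_sup (Submodule.mem_span_singleton_self v)
      (Submodule.mem_span_singleton_self w)

theorem exists_pointMap_eq_span (hC : IsCovering C) {v : V} (hv : v ≠ 0) :
    ∃ x, pointMap φ x = Submodule.span F {v} :=
  exists_pointMap_eq φ hC (nonzero_span_atom v hv)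

/-- A point lying on two distinct lines belongs to at most one block. -/
theorem ncard_blocksAt_le_one (hC : IsCovering C) {u v w : V}
    (h : ∀ a b c : F, a • u + b • v + c • w = 0 → a = 0 ∧ b = 0 ∧ c = 0) {x : U}
    (hx : pointMap φ x = Submodule.span F {u}) : (blocksAt C x).ncard ≤ 1 := by
  have huv : ∀ a b : F, a • u + b • v = 0 → a = 0 ∧ b = 0 := fun a b hab => by
    have := h a b 0 (by simpa using hab)
    exact ⟨this.1, this.2.1⟩
  have huw : ∀ a b : F, a • u + b • w = 0 → a = 0 ∧ b = 0 := fun a b hab => by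
    have := h a 0 b (by simpa using hab)
    exact ⟨this.1, this.2.2⟩
  have hvw : ∀ a b : F, a • v + b • w = 0 → a = 0 ∧ b = 0 := fun a b hab =>
    (h 0 a b (by simpa using hab)).2
  have hne : ∀ {v w : V}, (∀ a b : F, a • v + b • w = 0 → a = 0 ∧ b = 0) → w ≠ 0 ∧ v + w ≠ 0 :=
    fun h => ⟨fun h0 => one_ne_zero (h 0 1 (by simp [h0])).2,
      fun h0 => one_ne_zero (h 1 1 (by simpa using h0)).2⟩
  obtain ⟨y, hy⟩ := exists_pointMap_eq_span φ hC (hne huv).1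
  obtain ⟨z, hz⟩ := exists_pointMap_eq_span φ hC (hne huw).1
  obtain ⟨p, hp⟩ := exists_pointMap_eq_span φ hC (hne huv).2
  obtain ⟨r, hr⟩ := exists_pointMap_eq_span φ hC (hne huw).2
  -- The third points `p` and `r` serve only to make the lines circuits; what is kept is the bound
  -- on the blocks of two points.
  have hxy := (Set.ncard_le_ncard Set.subset_union_right (Set.toFinite _)).trans
    (ncard_blocksAt_line_le φ hC huv hx hy hp)
  have hxz := (Set.ncard_le_ncard Set.subset_union_right (Set.toFinite _)).trans
    (ncard_blocksAt_line_le φ hC huw hx hz hr)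
  have hyz : pointMap φ y ≠ pointMap φ z := by
    rw [hy, hz]; exact span_singleton_ne_of_linearIndependent hvw
  have hxy' : pointMap φ x ≠ pointMap φ y := by
    rw [hx, hy]; exact span_singleton_ne_of_linearIndependent huv
  have hxz' : pointMap φ x ≠ pointMap φ z := by
    rw [hx, hz]; exact span_singleton_ne_of_linearIndependent huw
  have h3 := ((isPartialTransversal_triple_iff φ hC hyz (ne_of_pointMap_ne φ hxy')
    (ne_of_pointMap_ne φ hxz')).2 (by
      rw [hx, hy, hz, Submodule.span_singleton_le_iff_mem, Submodule.mem_sup]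
      rintro ⟨v', hv', w', hw', hu⟩
      obtain ⟨b, rfl⟩ := Submodule.mem_span_singleton.1 hv'
      obtain ⟨c, rfl⟩ := Submodule.mem_span_singleton.1 hw'
      exact one_ne_zero (h 1 (-b) (-c) (by rw [← hu]; module)).1)).ncard_le
  rw [blocksMeeting_triple, Set.ncard_eq_three.2 ⟨x, y, z, ne_of_pointMap_ne φ hxy',
    ne_of_pointMap_ne φ hxz', ne_of_pointMap_ne φ hyz, rfl⟩] at h3
  by_contra! hcon
  -- Two blocks at `x` already exhaust those met by each line, so `y` and `z` add none.
  have e1 := Set.eq_of_subset_of_ncard_le (Set.subset_union_left (t := blocksAt C y))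
    (hxy.trans hcon) (Set.toFinite _)
  have e2 := Set.eq_of_subset_of_ncard_le (Set.subset_union_left (t := blocksAt C z))
    (hxz.trans hcon) (Set.toFinite _)
  rw [← Set.union_assoc, ← e1, ← e2] at h3
  rw [← e1] at hxy
  omega

theorem finrank_le_two (φ : FlatLattice C ≃o Submodule F V) (hC : IsCovering C) : Module.finrank F V ≤ 2 := by
  by_contra! hn
  have : Module.Finite F V := Module.finite_of_finrank_pos (by omega)
  -- Three members of a basis suffice: `e 0`, `e 1` and `e 0 + e 1` are collinear, and `e 2`
  -- supplies a second line through each.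
  have hli := (Module.finBasis F V).linearIndependent.comp _ (Fin.castLE_injective hn)
  rw [Fintype.linearIndependent_iff] at hli
  set e := (Module.finBasis F V : _ → V) ∘ Fin.castLE hn
  have h : ∀ a b c : F, a • e 0 + b • e 1 + c • e 2 = 0 → a = 0 ∧ b = 0 ∧ c = 0 := by
    intro a b c habc
    have := hli ![a, b, c] (by simpa [Fin.sum_univ_three] using habc)
    exact ⟨this 0, this 1, this 2⟩
  have h01 : ∀ a b : F, a • e 0 + b • e 1 = 0 → a = 0 ∧ b = 0 := fun a b hab => by
    have := h a b 0 (by simpa using hab)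
    exact ⟨this.1, this.2.1⟩
  have n0 : e 0 ≠ 0 := fun h0 => one_ne_zero (h01 1 0 (by simp [h0])).1
  have n1 : e 1 ≠ 0 := fun h0 => one_ne_zero (h01 0 1 (by simp [h0])).2
  have n2 : e 0 + e 1 ≠ 0 := fun h0 => one_ne_zero (h01 1 1 (by simpa using h0)).2
  obtain ⟨x, hx⟩ := exists_pointMap_eq_span φ hC n0
  obtain ⟨y, hy⟩ := exists_pointMap_eq_span φ hC n1
  obtain ⟨z, hz⟩ := exists_pointMap_eq_span φ hC n2
  have hx1 := ncard_blocksAt_le_one φ hC h hx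
  have hy1 := ncard_blocksAt_le_one (u := e 1) (v := e 0) (w := e 2) φ hC (fun a b c habc => by
    have := h b a c (by rw [← habc]; module)
    tauto) hy
  have hz1 := ncard_blocksAt_le_one (u := e 0 + e 1) (v := e 0) (w := e 2) φ hC
    (fun a b c habc => by
      have := h (a + b) a c (by rw [← habc]; module)
      grind) hz
  have hline := ncard_blocksAt_line_le φ hC h01 hx hy hz
  have hzx : pointMap φ z ≠ pointMap φ x := by
    rw [hx, hz]
    refine span_singleton_ne_of_linearIndependent fun a b hab => ?_
    have := h01 (a + b) a (by rw [← hab]; module)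
    grind
  have hzy : pointMap φ z ≠ pointMap φ y := by
    rw [hy, hz]
    refine span_singleton_ne_of_linearIndependent fun a b hab => ?_
    have := h01 a (a + b) (by rw [← hab]; module)
    grind
  have hxy : pointMap φ x ≠ pointMap φ y := by
    rw [hx, hy]; exact span_singleton_ne_of_linearIndependent h01
  rcases exists_two_le_ncard_of_ncard_union_le_two (blocksAt_nonempty hC z) (blocksAt_nonempty hC x)
    (blocksAt_nonempty hC y) (two_le_ncard_blocksAt_union φ hC hzx)
    (two_le_ncard_blocksAt_union φ hC hzy) (two_le_ncard_blocksAt_union φ hC hxy) hline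
    with h | h | h <;> omega

end subspaces

/-- In a lattice of height two with at least three points, the family `E` has one member. -/
theorem EFamily_eq_of_line {α : Type*} [CompleteLattice α] (φ : FlatLattice C ≃o α)
    (hC : IsCovering C) (hline : ∀ p r : α, IsAtom p → IsAtom r → p ≠ r → p ⊔ r = ⊤)
    {p r t : α} (hp : IsAtom p) (hr : IsAtom r) (ht : IsAtom t) (hpr : p ≠ r) (hpt : p ≠ t)
    (hrt : r ≠ t) : EFamily C = {Set.univ} := by
  obtain ⟨a, rfl⟩ := exists_pointMap_eq φ hC hp
  obtain ⟨b, rfl⟩ := exists_pointMap_eq φ hC hr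
  obtain ⟨c, rfl⟩ := exists_pointMap_eq φ hC ht
  have hcol : ∀ {x y z : U}, pointMap φ x ≠ pointMap φ y → pointMap φ x ≠ pointMap φ z →
      pointMap φ y ≠ pointMap φ z →
      (blocksAt C x ∪ (blocksAt C y ∪ blocksAt C z)).ncard ≤ 2 := fun {x y z} hxy hxz hyz =>
    ncard_blocksAt_collinear_le φ hC hxy hxz hyz
      ((hline _ _ (isAtom_pointMap φ hC y) (isAtom_pointMap φ hC z) hyz) ▸ le_top)
  have habc := hcol hpr hpt hrt
  set T := blocksAt C a ∪ (blocksAt C b ∪ blocksAt C c) with hT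
  have hTeq : ∀ S : Set (Set U), S ⊆ T → 2 ≤ S.ncard → S = T := fun S hS h2 =>
    Set.eq_of_subset_of_ncard_le hS (habc.trans h2) (Set.toFinite _)
  -- The blocks of two distinct points already fill `T`, so a third collinear point brings no new
  -- block.
  have hpair : ∀ {x y z : U}, blocksAt C x ⊆ T → blocksAt C y ⊆ T →
      pointMap φ x ≠ pointMap φ y → pointMap φ z ≠ pointMap φ x → pointMap φ z ≠ pointMap φ y →
      blocksAt C z ⊆ T := by
    intro x y z hx hy hxy hzx hzy
    have h2 := two_le_ncard_blocksAt_union φ hC hxy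
    have e1 := hTeq _ (Set.union_subset hx hy) h2
    have e2 := Set.eq_of_subset_of_ncard_le
      (Set.subset_union_right (s := blocksAt C z) (t := blocksAt C x ∪ blocksAt C y))
      ((hcol hzx hzy hxy).trans h2) (Set.toFinite _)
    rw [← e1, e2]
    exact Set.subset_union_left
  have ha : blocksAt C a ⊆ T := Set.subset_union_left
  have hb : blocksAt C b ⊆ T := Set.subset_union_left.trans Set.subset_union_right
  have hc : blocksAt C c ⊆ T := Set.subset_union_right.trans Set.subset_union_right
  have hall : ∀ z, blocksAt C z ⊆ T := by
    intro z
    -- `z` may span the same point as `a` or `b`; two reference points different from it are still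
    -- available among the three.
    by_cases hza : pointMap φ z = pointMap φ a
    · exact hpair hb hc hrt (hza ▸ hpr) (hza ▸ hpt)
    · by_cases hzb : pointMap φ z = pointMap φ b
      · exact hpair ha hc hpt hza (hzb ▸ hrt)
      · exact hpair ha hb hpr hza hzb
  have huniv : ∀ x, 2 ≤ (blocksAt C x).ncard → E C x = Set.univ := fun x hx =>
    Set.eq_univ_of_forall fun y => by
      change blocksAt C y ⊆ blocksAt C x
      rw [hTeq _ (hall x) hx]
      exact hall y
  obtain ⟨x, hx⟩ : ∃ x, 2 ≤ (blocksAt C x).ncard := by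
    rcases exists_two_le_ncard_of_ncard_union_le_two (blocksAt_nonempty hC a) (blocksAt_nonempty hC b)
      (blocksAt_nonempty hC c) (two_le_ncard_blocksAt_union φ hC hpr)
      (two_le_ncard_blocksAt_union φ hC hpt) (two_le_ncard_blocksAt_union φ hC hrt) habc
      with h | h | h
    exacts [⟨_, h⟩, ⟨_, h⟩, ⟨_, h⟩]
  ext S
  constructor
  · rintro ⟨y, hy, rfl⟩
    exact huniv y hy.ge
  · rintro rfl
    exact ⟨x, le_antisymm ((Set.ncard_le_ncard (hall x) (Set.toFinite _)).trans habc) hx,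
      (huniv x hx).symm⟩

/-! ### Reduced coverings and the number of points -/

theorem pointMap_injective_of_isReduced {α : Type*} [CompleteLattice α] (φ : FlatLattice C ≃o α)
    (hC : IsCovering C) (hred : IsReduced C) : Function.Injective (pointMap φ) := by
  intro x y hxy
  -- Distinct elements spanning the same point form a two-element circuit, hence meet just one block
  -- and are related by `Sim`.
  by_contra hne
  have h := ncard_blocksMeeting_lt
    (fun hI => (isPartialTransversal_pair_iff φ hC hne).1 hI hxy) (by
      rintro z (rfl | rfl)
      · exact (isPartialTransversal_singleton hC y).subset (by grind)
      · exact (isPartialTransversal_singleton hC x).subset (by grind))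
  rw [Set.ncard_pair hne, blocksMeeting_pair] at h
  have hpos : ∀ z, 1 ≤ (blocksAt C z).ncard := fun z =>
    (Set.ncard_pos (Set.toFinite _)).2 (blocksAt_nonempty hC z)
  have e1 := Set.eq_of_subset_of_ncard_le (Set.subset_union_left (s := blocksAt C x)
    (t := blocksAt C y)) (by have := hpos x; omega) (Set.toFinite _)
  have e2 := Set.eq_of_subset_of_ncard_le (Set.subset_union_right (s := blocksAt C x)
    (t := blocksAt C y)) (by have := hpos y; omega) (Set.toFinite _)
  refine hne (hred x y (Or.inr ⟨e1.trans e2.symm, ?_⟩))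
  rw [← e1] at h
  have := hpos x
  omega

theorem card_eq_of_isReduced {α : Type*} [CompleteLattice α] (φ : FlatLattice C ≃o α)
    (hC : IsCovering C) (hred : IsReduced C) : Nat.card U = {a : α | IsAtom a}.ncard := by
  rw [← Set.ncard_univ, ← Set.ncard_image_of_injective _ (pointMap_injective_of_isReduced φ hC hred)]
  congr 1
  ext a
  constructor
  · rintro ⟨x, -, rfl⟩
    exact isAtom_pointMap φ hC x
  · intro ha
    obtain ⟨x, hx⟩ := exists_pointMap_eq φ hC ha
    exact ⟨x, Set.mem_univ _, hx⟩

theorem height_eq_one_iff_isAtom {α : Type*} [PartialOrder α] [OrderBot α] {a : α} :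
    Order.height a = 1 ↔ IsAtom a := by
  have h1 : Order.height a ≤ 1 ↔ ∀ b < a, b = ⊥ := by
    rw [← Nat.cast_one, Order.height_le_coe_iff]
    simp [isMin_iff_eq_bot]
  rw [le_antisymm_iff, h1, Order.one_le_iff_ne_zero, Order.height_ne_zero, isMin_iff_eq_bot]
  exact and_comm

theorem ncard_level_one {α : Type*} [CompleteLattice α] (φ : FlatLattice C ≃o α) :
    (level (FlatLattice C) 1).ncard = {a : α | IsAtom a}.ncard := by
  rw [← Set.ncard_image_of_injective _ φ.injective]
  congr 1
  ext a
  simp only [level, Set.mem_image, Set.mem_ofPred_eq, Nat.cast_one, ← height_eq_one_iff_isAtom]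
  constructor
  · rintro ⟨x, hx, rfl⟩
    rwa [Order.height_orderIso]
  · exact fun ha => ⟨φ.symm a, by rwa [Order.height_orderIso], φ.apply_symm_apply a⟩

theorem ncard_isAtom_submodule_of_finrank_two {F : Type*} [Field F] [Finite F] {V : Type*}
    [AddCommGroup V] [Module F V] [FiniteDimensional F V] (h : Module.finrank F V = 2) :
    {W : Submodule F V | IsAtom W}.ncard = Nat.card F + 1 := by
  rw [← Projectivization.card_of_finrank_two F V h,
    Nat.card_congr (Projectivization.equivSubmodule F V), ← Nat.card_coe_set_eq]
  exact Nat.card_congr (Equiv.subtypeEquivRight fun W => Submodule.isAtom_iff_finrank_eq_one)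

theorem sup_eq_top_of_finrank_two {F : Type*} [Field F] {V : Type*} [AddCommGroup V]
    [Module F V] [FiniteDimensional F V] (h : Module.finrank F V = 2) {p r : Submodule F V}
    (hp : IsAtom p) (hr : IsAtom r) (hpr : p ≠ r) : p ⊔ r = ⊤ := by
  apply Submodule.eq_top_of_finrank_eq
  have h1 := Submodule.finrank_sup_add_finrank_inf_eq p r
  rw [(hp.disjoint_of_ne hr hpr).eq_bot, finrank_bot, Submodule.isAtom_iff_finrank_eq_one.1 hp,
    Submodule.isAtom_iff_finrank_eq_one.1 hr] at h1
  omega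

end CoveringLattice

theorem mainTheorem4 {U : Type*} [Finite U] (C : Set (Set U))
    (hC : CoveringLattice.IsCovering C)
    {F : Type*} [Field F] [Finite F] {V : Type*} [AddCommGroup V] [Module F V]
    [FiniteDimensional F V] (q n : ℕ) (hq : Nat.card F = q) (hn : Module.finrank F V = n)
    (hiso : Nonempty (CoveringLattice.FlatLattice C ≃o Submodule F V)) :
    n ≤ 2 ∧
      (n = 2 →
        (CoveringLattice.level (CoveringLattice.FlatLattice C) 1).ncard = q + 1 ∧
        (CoveringLattice.IsReduced C → Nat.card U = q + 1) ∧
        Setoid.IsPartition (CoveringLattice.EFamily C) ∧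
        CoveringLattice.numE C = 1) := by
  obtain ⟨φ⟩ := hiso
  subst hq hn
  refine ⟨CoveringLattice.finrank_le_two φ hC, fun h2 => ?_⟩
  have hcard := CoveringLattice.ncard_isAtom_submodule_of_finrank_two h2
  have hq : 1 < Nat.card F := Finite.one_lt_card
  -- Since `q ≥ 2`, the line has at least three points.
  obtain ⟨p, hp, r, hr, t, ht, hpr, hpt, hrt⟩ :=
    (Set.two_lt_ncard (Set.finite_of_ncard_pos (by omega))).1
      (show 2 < {W : Submodule F V | IsAtom W}.ncard by omega)
  have hE := CoveringLattice.EFamily_eq_of_line φ hC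
    (fun _ _ => CoveringLattice.sup_eq_top_of_finrank_two h2) hp hr ht hpr hpt hrt
  have hU : Nonempty U :=
    let ⟨x, _⟩ := CoveringLattice.exists_pointMap_eq φ hC hp
    ⟨x⟩
  refine ⟨(CoveringLattice.ncard_level_one φ).trans hcard,
    fun hred => (CoveringLattice.card_eq_of_isReduced φ hC hred).trans hcard, ?_, ?_⟩
  · rw [hE]
    refine ⟨fun h => Set.univ_nonempty.ne_empty h.symm, fun a => ⟨Set.univ, by simp, by simp⟩⟩
  · rw [CoveringLattice.numE, hE, Set.ncard_singleton]
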